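/- Let $\mathrm{KG}(1,0)$ be the distribution of $\frac{1}{2\pi^2}\sum_{k=1}^\infty \epsilon_k/k^2$, where $\epsilon_1,\epsilon_2,\dots$ are independent $\mathrm{Gamma}(1,1)$ (that is, standard exponential) random variables. Then $\mathrm{KG}(1,0)$ is concentrated on $(0,\infty)$ and has there a Lebesgue density with a (necessarily unique) version $p_{\mathrm{KG}}(\cdot;1,0)$ that is nonnegative and continuous on $(0,\infty)$. For every $x>0$ this density has the two alternating series representations $$p_{\mathrm{KG}}(x;1,0)=\sum_{n=0}^\infty(-1)^n a_n^L(x)=\sum_{n=0}^\infty(-1)^n a_n^R(x),$$ where both series converge absolutely, all $a_n^L(x)$ and $a_n^R(x)$ are positive, and $$a_n^L(x)=\begin{cases}\dfrac{2}{\pi^{1/2}(2x)^{3/2}}\exp\left(-\dfrac{n^2}{8x}\right) & (n \text{ odd}),\\[2ex] \dfrac{(n+1)^2}{\pi^{1/2}(2x)^{5/2}}\exp\left(-\dfrac{(n+1)^2}{8x}\right) & (n\text{ even}),\end{cases}\qquad a_n^R(x)=4\pi^2(n+1)^2\exp\{-2\pi^2(n+1)^2x\}.$$ -/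

import Mathlib

open MeasureTheory ProbabilityTheory

/-- The Kolmogorov-Gamma distribution `KG(b, c)` (for `b > 0`): the law of
`(1 / (2π²)) ∑_{k ≥ 1} ε_k / (k² + c² / (4π²))`, where `ε_1, ε_2, …` are independent
`Gamma(b, 1)` random variables (shape `b`, rate `1`). The sequence `ε` is realised as the coordinate
sequence of the infinite product measure; `ε k` below is the variable with index `k + 1`. -/
noncomputable def kgMeasure (b c : ℝ) : Measure ℝ :=
  (Measure.infinitePi (fun _ : ℕ => gammaMeasure b 1)).map
    (fun ε : ℕ → ℝ => 1 / (2 * Real.pi ^ 2) *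
      ∑' k : ℕ, ε k / (((k : ℝ) + 1) ^ 2 + c ^ 2 / (4 * Real.pi ^ 2)))

/-- `p` is (on `(0, ∞)`) the density of `KG(b, c)` with respect to Lebesgue measure. Since a density
is determined only almost everywhere, it is normalised to be the continuous version on `(0, ∞)`,
which makes its value at every `x > 0` meaningful. The values of `p` outside of `(0, ∞)` play no
role. -/
structure IsKGDensity (b c : ℝ) (p : ℝ → ℝ) : Prop where
  continuousOn : ContinuousOn p (Set.Ioi 0)
  nonneg : ∀ x : ℝ, 0 < x → 0 ≤ p x
  law_eq : kgMeasure b c =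
    (volume.restrict (Set.Ioi 0)).withDensity (fun x => ENNReal.ofReal (p x))

/-- The coefficients `a_n^L(x)`. -/
noncomputable def aL (n : ℕ) (x : ℝ) : ℝ :=
  if Odd n then
    2 / (Real.pi ^ (1 / 2 : ℝ) * (2 * x) ^ (3 / 2 : ℝ)) * Real.exp (-((n : ℝ) ^ 2 / (8 * x)))
  else
    ((n : ℝ) + 1) ^ 2 / (Real.pi ^ (1 / 2 : ℝ) * (2 * x) ^ (5 / 2 : ℝ)) *
      Real.exp (-(((n : ℝ) + 1) ^ 2 / (8 * x)))

/-- The coefficients `a_n^R(x)`. -/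
noncomputable def aR (n : ℕ) (x : ℝ) : ℝ :=
  4 * Real.pi ^ 2 * ((n : ℝ) + 1) ^ 2 *
    Real.exp (-(2 * Real.pi ^ 2 * ((n : ℝ) + 1) ^ 2 * x))

/-! The variable is `∑ ε k / kgRate k`, so its partial sums are hypoexponential: their tails are
combinations of `exp (-(kgRate k * x))` with partial-fraction weights (`measureReal_lt_partialSum`).
For the rates `2π²(k + 1)²` the weights are `2 (-1)ᵏ N!² / ((N - k - 1)! (N + k + 1)!)`
(`hypoCoeff_kgRate`), bounded by 2 with limit `2 (-1)ᵏ`. Dominated convergence gives the tail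
`kgTail` of the full sum, and minus its termwise derivative is the density, the series of the `aR
n`.

Since `1 - kgTail` is an alternating theta series over `ℤ`, Poisson summation rewrites it as
`(2πx)^(-1/2)` times a Gaussian sum over odd integers (`one_sub_kgTail`). Differentiating this
product gives two series, which are the even and the odd `aL n`. Continuity carries both expansions
to every admissible density. -/

/-! ### Partial-fraction weights and their closed form. -/

/-- The weights of the hypoexponential distribution with rates `v 0, …, v (N - 1)`. -/
noncomputable def hypoCoeff (v : ℕ → ℝ) (N k : ℕ) : ℝ :=
  ∏ j ∈ (Finset.range N).erase k, v j / (v j - v k)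

theorem hypoCoeff_succ (v : ℕ → ℝ) {N k : ℕ} (h : k < N) :
    hypoCoeff v (N + 1) k = hypoCoeff v N k * (v N / (v N - v k)) := by
  have : (Finset.range (N + 1)).erase k = insert N ((Finset.range N).erase k) := by
    ext j; simp only [Finset.mem_erase, Finset.mem_range, Finset.mem_insert]; omega
  rw [hypoCoeff, this, Finset.prod_insert (by simp), mul_comm, hypoCoeff]

/-- The Lagrange basis polynomials at the nodes `v k` sum to 1, and their values at 0 are these
weights. -/
theorem sum_hypoCoeff {v : ℕ → ℝ} (hv : Function.Injective v) (N : ℕ) :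
    ∑ k ∈ Finset.range (N + 1), hypoCoeff v (N + 1) k = 1 := by
  have h := congrArg (Polynomial.eval 0) (Lagrange.sum_basis (s := Finset.range (N + 1))
    (v := v) hv.injOn ⟨0, by simp⟩)
  rw [Polynomial.eval_finsetSum, Polynomial.eval_one] at h
  rw [← h]
  refine Finset.sum_congr rfl fun k _ => ?_
  rw [hypoCoeff, Lagrange.basis, Polynomial.eval_prod]
  refine Finset.prod_congr rfl fun j hj => ?_
  have hne : v j - v k ≠ 0 := sub_ne_zero.2 (hv.ne (Finset.ne_of_mem_erase hj))
  have hne' : v k - v j ≠ 0 := sub_ne_zero.2 (hv.ne (Finset.ne_of_mem_erase hj).symm)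
  simp only [Lagrange.basisDivisor, Polynomial.eval_mul, Polynomial.eval_C, Polynomial.eval_sub,
    Polynomial.eval_X]
  field_simp
  ring

/-- The ratio `N!² / ((N - K)! (N + K)!)`, which vanishes for `N < K`. -/
noncomputable def centralRatio (K N : ℕ) : ℝ :=
  ∏ i ∈ Finset.range K, ((N : ℝ) - i) / (N + 1 + i)

theorem abs_centralRatio_le_one (K N : ℕ) : |centralRatio K N| ≤ 1 := by
  rcases lt_or_ge N K with h | h
  · rw [centralRatio, Finset.prod_eq_zero (Finset.mem_range.2 h) (by simp)]
    simp
  · rw [centralRatio, Finset.abs_prod]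
    refine Finset.prod_le_one (fun _ _ => abs_nonneg _) fun i hi => ?_
    have hi' : (i : ℝ) ≤ N := by
      exact_mod_cast (Finset.mem_range.1 hi).le.trans h
    rw [abs_of_nonneg (div_nonneg (by linarith) (by positivity)), div_le_one (by positivity)]
    have : (0 : ℝ) ≤ i := by positivity
    linarith

theorem centralRatio_of_lt {K N : ℕ} (h : N < K) : centralRatio K N = 0 := by
  rw [centralRatio, Finset.prod_eq_zero (Finset.mem_range.2 h) (by simp)]

theorem tendsto_centralRatio (K : ℕ) :
    Filter.Tendsto (centralRatio K) Filter.atTop (nhds 1) := by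
  have : ∀ i ∈ Finset.range K, Filter.Tendsto (fun N : ℕ => ((N : ℝ) - i) / (N + 1 + i))
      Filter.atTop (nhds 1) := by
    intro i _
    -- Each factor is `1 - (2i + 1) / (N + i + 1)`.
    have h := (tendsto_const_div_atTop_nhds_zero_nat (2 * (i : ℝ) + 1)).comp
      (Filter.tendsto_add_atTop_nat (i + 1))
    have h2 := (tendsto_const_nhds (x := (1 : ℝ))).sub h
    rw [sub_zero] at h2
    refine h2.congr fun N => ?_
    simp only [Function.comp]
    push_cast
    field_simp
    ring
  have h := tendsto_finsetProd _ this
  rw [Finset.prod_const_one] at h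
  exact h

/-- Clearing denominators keeps this recursion valid when `N + 1 = K`. With `K = k + 1` it matches
the factor by which `hypoCoeff kgRate N k` changes with `N`. -/
theorem centralRatio_succ_mul (K N : ℕ) :
    centralRatio K (N + 1) * (((N : ℝ) + 1 - K) * (N + 1 + K)) =
      centralRatio K N * ((N : ℝ) + 1) ^ 2 := by
  induction K with
  | zero => simp [centralRatio]; ring
  | succ K ih =>
    have hs : ∀ M : ℕ, centralRatio (K + 1) M = centralRatio K M * (((M : ℝ) - K) / (M + 1 + K)) :=
      fun M => Finset.prod_range_succ _ _
    rw [hs, hs]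
    push_cast
    have e : centralRatio K (N + 1) * (((N : ℝ) + 1 - K) / (N + 1 + 1 + K)) *
        ((N + 1 - (K + 1)) * (N + 1 + (K + 1))) =
        centralRatio K (N + 1) * (((N : ℝ) + 1 - K) * (N + 1 + K)) * ((N - K) / (N + 1 + K)) := by
      field_simp
      ring
    rw [e, ih]
    ring

/-- The exponential rates `2π²(k + 1)²`. -/
noncomputable def kgRate (k : ℕ) : ℝ := 2 * Real.pi ^ 2 * ((k : ℝ) + 1) ^ 2

theorem kgRate_pos (k : ℕ) : 0 < kgRate k := by
  unfold kgRate; positivity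

theorem kgRate_injective : Function.Injective kgRate := by
  intro j k h
  have h1 : ((j : ℝ) + 1) ^ 2 = ((k : ℝ) + 1) ^ 2 :=
    mul_left_cancel₀ (by positivity : 2 * Real.pi ^ 2 ≠ 0) h
  have h2 := (sq_eq_sq₀ (by positivity) (by positivity)).1 h1
  exact_mod_cast add_right_cancel h2

theorem kgRate_div (j k : ℕ) : kgRate j / (kgRate j - kgRate k) =
    ((j : ℝ) + 1) ^ 2 / (((j : ℝ) - k) * (j + 1 + (k + 1))) := by
  have h : (2 * Real.pi ^ 2 : ℝ) ≠ 0 := by positivity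
  rw [kgRate, kgRate, ← mul_sub, mul_div_mul_left _ _ h]
  congr 1
  ring

/-- The 2 arises because the last denominator in `centralRatio (k + 1) (k + 1)` is `2 (k + 1)`,
against the factor `k + 1` of `(k + 1)!`. -/
theorem hypoCoeff_kgRate_self (k : ℕ) :
    hypoCoeff kgRate (k + 1) k = 2 * (-1) ^ k * centralRatio (k + 1) (k + 1) := by
  have h1 : (Finset.range (k + 1)).erase k = Finset.range k := by
    ext j; simp only [Finset.mem_erase, Finset.mem_range]; omega
  have h2 : ∏ j ∈ Finset.range k, ((k : ℝ) - j) = ∏ j ∈ Finset.range k, ((j : ℝ) + 1) := by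
    rw [← Finset.prod_range_reflect]
    refine Finset.prod_congr rfl fun j hj => ?_
    have := Finset.mem_range.1 hj
    rw [Nat.sub_sub, Nat.cast_sub (by omega)]
    push_cast
    ring
  have h3 : ∏ j ∈ Finset.range (k + 1), (((k + 1 : ℕ) : ℝ) - j) =
      ∏ j ∈ Finset.range (k + 1), ((j : ℝ) + 1) := by
    rw [← Finset.prod_range_reflect]
    refine Finset.prod_congr rfl fun j hj => ?_
    have := Finset.mem_range.1 hj
    rw [Nat.sub_sub, Nat.cast_sub (by omega)]
    push_cast
    ring
  have h4 : ∏ j ∈ Finset.range k, ((j : ℝ) - k) =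
      (-1) ^ k * ∏ j ∈ Finset.range k, ((j : ℝ) + 1) := by
    have h := Finset.prod_mul_distrib (s := Finset.range k) (f := fun _ => (-1 : ℝ))
      (g := fun j => (k : ℝ) - j)
    rw [Finset.prod_const, Finset.card_range, h2] at h
    rw [← h]
    exact Finset.prod_congr rfl fun j _ => by ring
  have hp : ∏ j ∈ Finset.range k, ((j : ℝ) + 1) ≠ 0 :=
    Finset.prod_ne_zero_iff.2 fun j _ => by positivity
  have hq : ∏ j ∈ Finset.range k, ((j : ℝ) + 1 + (k + 1)) ≠ 0 :=
    Finset.prod_ne_zero_iff.2 fun j _ => by positivity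
  have h5 : ∏ j ∈ Finset.range (k + 1), (((k + 1 : ℕ) : ℝ) + 1 + j) =
      (∏ j ∈ Finset.range k, ((j : ℝ) + 1 + (k + 1))) * (2 * (k + 1)) := by
    rw [Finset.prod_range_succ]
    push_cast
    congr 1
    · exact Finset.prod_congr rfl fun j _ => by ring
    · ring
  have hs : ((-1 : ℝ) ^ k) * (-1) ^ k = 1 := by rw [← mul_pow]; simp
  rw [hypoCoeff, h1]
  simp only [kgRate_div]
  rw [centralRatio, Finset.prod_div_distrib, Finset.prod_div_distrib, h3, h5,
    Finset.prod_mul_distrib, h4, Finset.prod_pow, Finset.prod_range_succ]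
  set s := (-1 : ℝ) ^ k
  have hs0 : s ≠ 0 := fun h => by simp [h] at hs
  have hs2 : s ^ 2 = 1 := by rw [sq]; exact hs
  field_simp
  rw [hs2]

theorem hypoCoeff_kgRate {N k : ℕ} (h : k < N) :
    hypoCoeff kgRate N k = 2 * (-1) ^ k * centralRatio (k + 1) N := by
  induction N, h using Nat.le_induction with
  | base => exact hypoCoeff_kgRate_self k
  | succ N hN ih =>
    rw [hypoCoeff_succ _ hN, ih, kgRate_div]
    have hlt : (k : ℝ) + 1 ≤ N := by exact_mod_cast hN
    have hne : (N : ℝ) - k ≠ 0 := by linarith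
    have hr := centralRatio_succ_mul (k + 1) N
    push_cast at hr
    field_simp
    linear_combination -hr

/-! ### The limiting tail series. -/

/-- The tail function `∑ 2 (-1)ᵏ exp (-2π²(k + 1)² x)`. -/
noncomputable def kgTail (x : ℝ) : ℝ := ∑' k : ℕ, 2 * (-1) ^ k * Real.exp (-(kgRate k * x))

theorem summable_kgRate_mul_exp {x : ℝ} (hx : 0 < x) :
    Summable fun k : ℕ => kgRate k * Real.exp (-(kgRate k * x)) := by
  have h := ((summable_nat_add_iff 1).2 (Real.summable_pow_mul_exp_neg_nat_mul 2
    (by positivity : 0 < 2 * Real.pi ^ 2 * x))).mul_left (2 * Real.pi ^ 2)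
  refine Summable.of_nonneg_of_le (fun k => mul_nonneg (kgRate_pos k).le (Real.exp_nonneg _))
    (fun k => ?_) h
  push_cast
  rw [kgRate, mul_assoc (2 * Real.pi ^ 2)]
  gcongr ?_ * (?_ * Real.exp ?_)
  have h1 : (k : ℝ) + 1 ≤ (k + 1) ^ 2 := by nlinarith [Nat.cast_nonneg (α := ℝ) k]
  have : 2 * Real.pi ^ 2 * x * (k + 1) ≤ 2 * Real.pi ^ 2 * x * (k + 1) ^ 2 := by gcongr
  linarith

theorem one_le_kgRate (k : ℕ) : 1 ≤ kgRate k := by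
  have h1 : (1 : ℝ) ≤ ((k : ℝ) + 1) ^ 2 := by nlinarith [Nat.cast_nonneg (α := ℝ) k]
  have h2 : (1 : ℝ) ≤ 2 * Real.pi ^ 2 := by nlinarith [Real.pi_gt_three]
  exact one_le_mul_of_one_le_of_one_le h2 h1

theorem summable_exp_kgRate {x : ℝ} (hx : 0 < x) :
    Summable fun k : ℕ => Real.exp (-(kgRate k * x)) :=
  Summable.of_nonneg_of_le (fun _ => Real.exp_nonneg _)
    (fun k => le_mul_of_one_le_left (Real.exp_nonneg _) (one_le_kgRate k))
    (summable_kgRate_mul_exp hx)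

/-- The closed form vanishes for `k ≥ N`, so the finite sums extend to all of `ℕ`, where `2 exp
(-(kgRate k * x))` dominates. -/
theorem tendsto_sum_hypoCoeff {x : ℝ} (hx : 0 < x) :
    Filter.Tendsto (fun N => ∑ k ∈ Finset.range N,
      hypoCoeff kgRate N k * Real.exp (-(kgRate k * x))) Filter.atTop (nhds (kgTail x)) := by
  have h : Filter.Tendsto (fun N => ∑' k : ℕ, 2 * (-1) ^ k * centralRatio (k + 1) N *
      Real.exp (-(kgRate k * x))) Filter.atTop (nhds (kgTail x)) := by
    refine tendsto_tsum_of_dominated_convergence ((summable_exp_kgRate hx).mul_left 2)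
      (fun k => ?_) (Filter.Eventually.of_forall fun N k => ?_)
    · simpa using ((tendsto_centralRatio (k + 1)).const_mul (2 * (-1) ^ k)).mul_const
        (Real.exp (-(kgRate k * x)))
    · rw [norm_mul, norm_mul, norm_mul, norm_pow, Real.norm_eq_abs (Real.exp _), Real.abs_exp]
      gcongr
      simpa using abs_centralRatio_le_one (k + 1) N
  refine h.congr fun N => ?_
  rw [tsum_eq_sum (s := Finset.range N)]
  · exact Finset.sum_congr rfl fun k hk => by rw [hypoCoeff_kgRate (Finset.mem_range.1 hk)]
  · intro k hk
    rw [centralRatio_of_lt (by simpa [Nat.lt_succ_iff] using hk)]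
    simp

/-! ### Tails of finite sums of independent exponentials. -/

theorem gammaMeasure_one_one : gammaMeasure 1 1 =
    (volume.restrict (Set.Ioi 0)).withDensity (fun t => ENNReal.ofReal (Real.exp (-t))) := by
  rw [Measure.restrict_congr_set Ioi_ae_eq_Ici, ← withDensity_indicator measurableSet_Ici, gammaMeasure]
  congr 1
  ext t
  rcases le_or_gt 0 t with h | h
  · rw [gammaPDF_of_nonneg h, Set.indicator_of_mem (by exact h)]
    simp
  · rw [gammaPDF_of_neg h, Set.indicator_of_notMem (by simpa using h)]

/-- Fubini for the product law of `(A, B)`, conditioning on `B = t`. -/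
theorem measure_lt_add_div_eq {Ω : Type*} [MeasurableSpace Ω] {μ : Measure Ω}
    [IsProbabilityMeasure μ] {A B : Ω → ℝ} (hA : Measurable A) (hB : Measurable B)
    (hAB : IndepFun A B μ) (hBlaw : μ.map B = gammaMeasure 1 1) {l : ℝ} (x : ℝ) :
    μ {ω | x < A ω + B ω / l} =
      ∫⁻ t in Set.Ioi 0, ENNReal.ofReal (Real.exp (-t)) * μ {ω | x - t / l < A ω} := by
  have hprod := (indepFun_iff_map_prod_eq_prod_map_map hA.aemeasurable hB.aemeasurable).1 hAB
  have hS : MeasurableSet {p : ℝ × ℝ | x < p.1 + p.2 / l} :=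
    measurableSet_lt (by fun_prop) (by fun_prop)
  have : IsProbabilityMeasure (μ.map A) := Measure.isProbabilityMeasure_map hA.aemeasurable
  have : IsProbabilityMeasure (gammaMeasure 1 1) :=
    isProbabilityMeasure_gammaMeasure one_pos one_pos
  have h1 : μ {ω | x < A ω + B ω / l} =
      μ.map (fun ω => (A ω, B ω)) {p : ℝ × ℝ | x < p.1 + p.2 / l} := by
    rw [Measure.map_apply (hA.prodMk hB) hS]
    rfl
  have hm : Measurable fun t : ℝ => μ.map A ((fun a => (a, t)) ⁻¹' {p : ℝ × ℝ | x < p.1 + p.2 / l}) :=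
    measurable_measure_prodMk_right hS
  rw [h1, hprod, hBlaw, Measure.prod_apply_symm hS, gammaMeasure_one_one,
    lintegral_withDensity_eq_lintegral_mul _ (by fun_prop) hm]
  refine lintegral_congr fun t => ?_
  rw [Pi.mul_apply, Measure.map_apply hA (by exact measurable_prodMk_right hS)]
  congr 2
  ext ω
  simp [sub_lt_iff_lt_add]

theorem integral_exp_neg_mul_sum {s : Finset ℕ} {c v : ℕ → ℝ} {l : ℝ} (hl : l ≠ 0)
    (hv : ∀ k ∈ s, v k ≠ l) (x : ℝ) :
    ∫ t in (0 : ℝ)..(l * x),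
        Real.exp (-t) * ∑ k ∈ s, c k * Real.exp (-(v k * (x - t / l))) =
      ∑ k ∈ s, c k * (l / (l - v k)) * (Real.exp (-(v k * x)) - Real.exp (-(l * x))) := by
  have hd : ∀ t : ℝ, HasDerivAt
      (fun t => ∑ k ∈ s, c k * (l / (v k - l)) * Real.exp (-(v k * (x - t / l)) - t))
      (Real.exp (-t) * ∑ k ∈ s, c k * Real.exp (-(v k * (x - t / l)))) t := by
    intro t
    rw [Finset.mul_sum]
    refine HasDerivAt.fun_sum fun k hk => ?_
    have h0 : HasDerivAt (fun t : ℝ => -(v k * (x - t / l)) - t) (-(v k * (0 - 1 / l)) - 1) t :=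
      ((((hasDerivAt_const t x).sub ((hasDerivAt_id t).div_const l)).const_mul (v k)).neg).sub
        (hasDerivAt_id t)
    refine (h0.exp.const_mul (c k * (l / (v k - l)))).congr_deriv ?_
    have hne : v k - l ≠ 0 := sub_ne_zero.2 (hv k hk)
    rw [sub_eq_add_neg _ t, Real.exp_add]
    field_simp
    ring
  rw [intervalIntegral.integral_eq_sub_of_hasDerivAt (fun t _ => hd t)
    (Continuous.intervalIntegrable (by fun_prop) _ _), ← Finset.sum_sub_distrib]
  refine Finset.sum_congr rfl fun k hk => ?_
  have hne : v k - l ≠ 0 := sub_ne_zero.2 (hv k hk)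
  have hne' : l - v k ≠ 0 := sub_ne_zero.2 (hv k hk).symm
  have e1 : -(v k * (x - l * x / l)) - l * x = -(l * x) := by field_simp; ring
  have e2 : -(v k * (x - 0 / l)) - 0 = -(v k * x) := by ring
  rw [e1, e2]
  field_simp
  ring

/-- Adding an independent exponential variable of rate `l` to a nonnegative variable whose tail is a
combination of exponentials. -/
theorem measure_lt_add_exponential {Ω : Type*} [MeasurableSpace Ω] {μ : Measure Ω}
    [IsProbabilityMeasure μ] {A B : Ω → ℝ} (hA : Measurable A) (hB : Measurable B)
    (hAB : IndepFun A B μ) (hBlaw : μ.map B = gammaMeasure 1 1) (hA0 : ∀ᵐ ω ∂μ, 0 ≤ A ω)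
    {s : Finset ℕ} {c v : ℕ → ℝ} {l : ℝ} (hl : 0 < l) (hv : ∀ k ∈ s, v k ≠ l)
    (htail : ∀ x, 0 ≤ x →
      μ.real {ω | x < A ω} = ∑ k ∈ s, c k * Real.exp (-(v k * x)))
    {x : ℝ} (hx : 0 ≤ x) :
    μ.real {ω | x < A ω + B ω / l} = Real.exp (-(l * x)) +
      ∑ k ∈ s, c k * (l / (l - v k)) * (Real.exp (-(v k * x)) - Real.exp (-(l * x))) := by
  have hlx : 0 ≤ l * x := by positivity
  set g : ℝ → ℝ := fun t => Real.exp (-t) * ∑ k ∈ s, c k * Real.exp (-(v k * (x - t / l)))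
  have hg : Continuous g := by fun_prop
  have hg_eq : ∀ t ∈ Set.Ioc 0 (l * x),
      g t = Real.exp (-t) * μ.real {ω | x - t / l < A ω} := by
    intro t ht
    rw [htail]
    rw [sub_nonneg, div_le_iff₀ hl, mul_comm]
    exact ht.2
  -- The integral is split at `t = l * x`: up to there the threshold `x - t / l` is nonnegative and
  -- `htail` applies; beyond it the threshold is negative and the event has probability 1.
  have h1 : ∫⁻ t in Set.Ioc 0 (l * x),
      ENNReal.ofReal (Real.exp (-t)) * μ {ω | x - t / l < A ω} =
      ENNReal.ofReal (∫ t in (0 : ℝ)..(l * x), g t) := by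
    rw [intervalIntegral.integral_of_le hlx, ofReal_integral_eq_lintegral_ofReal
      (hg.integrableOn_Ioc) ?_]
    · refine setLIntegral_congr_fun measurableSet_Ioc fun t ht => ?_
      rw [hg_eq t ht, ENNReal.ofReal_mul (Real.exp_nonneg _), ofReal_measureReal]
    · filter_upwards [ae_restrict_mem measurableSet_Ioc] with t ht
      rw [hg_eq t ht]
      exact mul_nonneg (Real.exp_nonneg _) measureReal_nonneg
  have h2 : ∫⁻ t in Set.Ioi (l * x),
      ENNReal.ofReal (Real.exp (-t)) * μ {ω | x - t / l < A ω} =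
      ENNReal.ofReal (Real.exp (-(l * x))) := by
    rw [← integral_exp_neg_Ioi, ofReal_integral_eq_lintegral_ofReal
      (integrableOn_exp_neg_Ioi _) (ae_of_all _ fun _ => Real.exp_nonneg _)]
    refine setLIntegral_congr_fun measurableSet_Ioi fun t ht => ?_
    have hlt : x - t / l < 0 := by
      rw [sub_neg, lt_div_iff₀ hl, mul_comm]
      exact ht
    have : μ {ω | x - t / l < A ω} = 1 := by
      rw [← measure_univ (μ := μ)]
      refine measure_congr ?_
      filter_upwards [hA0] with ω hω
      exact eq_true (hlt.trans_le hω)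
    simp only [this, mul_one]
  have hnn : 0 ≤ ∫ t in (0 : ℝ)..(l * x), g t := by
    rw [intervalIntegral.integral_of_le hlx]
    refine setIntegral_nonneg measurableSet_Ioc fun t ht => ?_
    rw [hg_eq t ht]
    exact mul_nonneg (Real.exp_nonneg _) measureReal_nonneg
  rw [measureReal_def, measure_lt_add_div_eq hA hB hAB hBlaw, ← Set.Ioc_union_Ioi_eq_Ioi hlx,
    lintegral_union measurableSet_Ioi (Set.Ioc_disjoint_Ioi le_rfl), h1, h2,
    ← ENNReal.ofReal_add hnn (Real.exp_nonneg _),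
    ENNReal.toReal_ofReal (add_nonneg hnn (Real.exp_nonneg _)), add_comm,
    integral_exp_neg_mul_sum hl.ne' hv]

/-- The joint law of the standard exponential variables. -/
noncomputable abbrev expSeqMeasure : Measure (ℕ → ℝ) :=
  Measure.infinitePi (fun _ : ℕ => gammaMeasure 1 1)

instance isProbabilityMeasure_gammaMeasure_one_one : IsProbabilityMeasure (gammaMeasure 1 1) :=
  isProbabilityMeasure_gammaMeasure one_pos one_pos

theorem map_eval_expSeqMeasure (n : ℕ) :
    expSeqMeasure.map (fun ε => ε n) = gammaMeasure 1 1 :=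
  Measure.infinitePi_map_eval _ n

theorem ae_pos_expSeqMeasure : ∀ᵐ ε ∂expSeqMeasure, ∀ n, 0 < ε n := by
  rw [ae_all_iff]
  intro n
  have h : ∀ᵐ t ∂(gammaMeasure 1 1), (0 : ℝ) < t := by
    rw [gammaMeasure_one_one]
    exact (withDensity_absolutelyContinuous _ _) (ae_restrict_mem measurableSet_Ioi)
  rw [← map_eval_expSeqMeasure n] at h
  exact ae_of_ae_map (measurable_pi_apply n).aemeasurable h

theorem measureReal_lt_partialSum {v : ℕ → ℝ} (hv : Function.Injective v) (hpos : ∀ k, 0 < v k)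
    (N : ℕ) {x : ℝ} (hx : 0 ≤ x) :
    expSeqMeasure.real {ε | x < ∑ k ∈ Finset.range N, ε k / v k} =
      ∑ k ∈ Finset.range N, hypoCoeff v N k * Real.exp (-(v k * x)) := by
  induction N generalizing x with
  | zero => simp [not_lt.2 hx]
  | succ N ih =>
    have hind : iIndepFun (fun (n : ℕ) (ε : ℕ → ℝ) => ε n) expSeqMeasure :=
      iIndepFun_infinitePi (X := fun _ t => t) (fun _ => measurable_id)
    have hind2 : iIndepFun (fun (n : ℕ) (ε : ℕ → ℝ) => ε n / v n * 1) expSeqMeasure :=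
      hind.comp (fun n t => t / v n * 1) (fun n => by fun_prop)
    have hAB : IndepFun (fun ε : ℕ → ℝ => ∑ k ∈ Finset.range N, ε k / v k) (fun ε => ε N)
        expSeqMeasure := by
      have h := hind2.indepFun_finsetSum_of_notMem (s := Finset.range N) (i := N)
        (fun n => by fun_prop) (by simp)
      -- Multiplying by `v N` turns the scaled summand back into `ε N`.
      have h' := h.comp (measurable_id) (measurable_mul_const (v N))
      convert! h' using 1
      · ext ε; simp
      · ext ε; simp [(hpos N).ne']
    have hm := measure_lt_add_exponential (μ := expSeqMeasure) (by fun_prop) (by fun_prop) hAB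
      (map_eval_expSeqMeasure N)
      (by
        filter_upwards [ae_pos_expSeqMeasure] with ε hε
        exact Finset.sum_nonneg fun k _ => (div_pos (hε k) (hpos k)).le)
      (hpos N) (v := v)
      (fun k hk => hv.ne (Finset.mem_range.1 hk).ne) (fun x hx => ih hx) hx
    simp only [Finset.sum_range_succ _ N]
    rw [hm]
    -- As the weights sum to 1, what remains in front of `exp (-(v N * x))` is exactly `hypoCoeff v
    -- (N + 1) N`.
    have hsum := sum_hypoCoeff hv N
    have hc : ∀ k ∈ Finset.range N,
        hypoCoeff v (N + 1) k = hypoCoeff v N k * (v N / (v N - v k)) :=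
      fun k hk => hypoCoeff_succ v (Finset.mem_range.1 hk)
    rw [Finset.sum_range_succ] at hsum
    have e : ∀ k ∈ Finset.range N, hypoCoeff v N k * (v N / (v N - v k)) *
        (Real.exp (-(v k * x)) - Real.exp (-(v N * x))) =
        hypoCoeff v (N + 1) k * Real.exp (-(v k * x)) -
          hypoCoeff v (N + 1) k * Real.exp (-(v N * x)) :=
      fun k hk => by rw [hc k hk, mul_sub]
    rw [Finset.sum_congr rfl e, Finset.sum_sub_distrib, ← Finset.sum_mul]
    linear_combination -Real.exp (-(v N * x)) * hsum

/-! ### Almost sure convergence and the law of the infinite sum. -/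

theorem lintegral_ofReal_gammaMeasure_ne_top :
    ∫⁻ t, ENNReal.ofReal t ∂(gammaMeasure 1 1) ≠ ⊤ := by
  rw [gammaMeasure_one_one, lintegral_withDensity_eq_lintegral_mul _ (by fun_prop) (by fun_prop)]
  -- The mean is the Gamma integral at 2.
  have h := (Real.GammaIntegral_convergent (s := 2) (by norm_num)).lintegral_lt_top
  refine (lt_of_le_of_lt (le_of_eq ?_) h).ne
  refine lintegral_congr fun t => ?_
  rw [Pi.mul_apply, ← ENNReal.ofReal_mul (Real.exp_nonneg _)]
  norm_num

/-- By Tonelli the sum has finite expectation, hence is almost surely finite. -/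
theorem ae_summable_expSeq {v : ℕ → ℝ} (hpos : ∀ k, 0 < v k) (hv : Summable fun k => 1 / v k) :
    ∀ᵐ ε ∂expSeqMeasure, Summable fun k => ε k / v k := by
  have h1 : ∫⁻ ε, ∑' k, ENNReal.ofReal (1 / v k) * ENNReal.ofReal (ε k) ∂expSeqMeasure ≠ ⊤ := by
    rw [lintegral_tsum fun k => (by fun_prop : Measurable _).aemeasurable]
    have h2 : ∀ k, ∫⁻ ε, ENNReal.ofReal (1 / v k) * ENNReal.ofReal (ε k) ∂expSeqMeasure =
        ENNReal.ofReal (1 / v k) * ∫⁻ t, ENNReal.ofReal t ∂(gammaMeasure 1 1) := fun k => by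
      rw [lintegral_const_mul _ (by fun_prop), ← map_eval_expSeqMeasure k,
        lintegral_map (by fun_prop) (by fun_prop)]
    simp_rw [h2]
    rw [ENNReal.tsum_mul_right]
    exact ENNReal.mul_ne_top hv.tsum_ofReal_ne_top lintegral_ofReal_gammaMeasure_ne_top
  have h3 := ae_lt_top (by fun_prop) h1
  filter_upwards [h3, ae_pos_expSeqMeasure] with ε hε hp
  have h4 := ENNReal.summable_toReal hε.ne
  refine h4.congr fun k => ?_
  rw [ENNReal.toReal_mul, ENNReal.toReal_ofReal (hp k).le,
    ENNReal.toReal_ofReal (one_div_pos.2 (hpos k)).le]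
  ring

/-- For positive terms the events increase with `N`. The strict inequality makes their union the
limiting event: a sum exceeding `x` has a partial sum exceeding `x`. -/
theorem tendsto_measureReal_lt_partialSum {v : ℕ → ℝ} (hpos : ∀ k, 0 < v k)
    (hv : Summable fun k => 1 / v k) (x : ℝ) :
    Filter.Tendsto (fun N => expSeqMeasure.real {ε | x < ∑ k ∈ Finset.range N, ε k / v k})
      Filter.atTop (nhds (expSeqMeasure.real {ε | x < ∑' k, ε k / v k})) := by
  set P : Set (ℕ → ℝ) := {ε | ∀ n, 0 < ε n}
  have hmono : Monotone fun N => {ε | ε ∈ P ∧ x < ∑ k ∈ Finset.range N, ε k / v k} := by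
    intro M N hMN ε hε
    refine ⟨hε.1, hε.2.trans_le ?_⟩
    exact Finset.sum_le_sum_of_subset_of_nonneg (Finset.range_mono hMN)
      fun k _ _ => (div_pos (hε.1 k) (hpos k)).le
  have h := tendsto_measure_iUnion_atTop (μ := expSeqMeasure) hmono
  have hN : ∀ N, expSeqMeasure {ε | ε ∈ P ∧ x < ∑ k ∈ Finset.range N, ε k / v k} =
      expSeqMeasure {ε | x < ∑ k ∈ Finset.range N, ε k / v k} := fun N => by
    refine measure_congr ?_
    filter_upwards [ae_pos_expSeqMeasure] with ε hε
    exact propext (and_iff_right hε)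
  have hU : expSeqMeasure (⋃ N, {ε | ε ∈ P ∧ x < ∑ k ∈ Finset.range N, ε k / v k}) =
      expSeqMeasure {ε | x < ∑' k, ε k / v k} := by
    refine measure_congr ?_
    filter_upwards [ae_pos_expSeqMeasure, ae_summable_expSeq hpos hv] with ε hε hs
    have hnn : ∀ k, 0 ≤ ε k / v k := fun k => (div_pos (hε k) (hpos k)).le
    refine propext ⟨fun h => ?_, fun h => ?_⟩
    · obtain ⟨N, hN⟩ := Set.mem_iUnion.1 h
      exact hN.2.trans_le (hs.sum_le_tsum _ fun k _ => hnn k)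
    · obtain ⟨N, hN⟩ := (hs.hasSum.tendsto_sum_nat.eventually_const_lt h).exists
      exact Set.mem_iUnion.2 ⟨N, hε, hN⟩
  simp only [Function.comp_def, hN, hU] at h
  exact (ENNReal.tendsto_toReal (measure_ne_top _ _)).comp h

/-- Needed because `Measure.map` is zero by default for a map that is not a.e. measurable. -/
theorem aemeasurable_tsum_expSeq {v : ℕ → ℝ} (hpos : ∀ k, 0 < v k)
    (hv : Summable fun k => 1 / v k) :
    AEMeasurable (fun ε : ℕ → ℝ => ∑' k, ε k / v k) expSeqMeasure := by
  refine aemeasurable_of_tendsto_metrizable_ae Filter.atTop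
    (f := fun N (ε : ℕ → ℝ) => ∑ k ∈ Finset.range N, ε k / v k) 
    (fun N => (by fun_prop : Measurable _).aemeasurable) ?_
  filter_upwards [ae_summable_expSeq hpos hv] with ε hs
  exact hs.hasSum.tendsto_sum_nat

theorem summable_one_div_kgRate : Summable fun k => 1 / kgRate k := by
  have h := ((summable_nat_add_iff 1).2 (Real.summable_one_div_nat_pow.2 one_lt_two)).mul_left
    (1 / (2 * Real.pi ^ 2))
  refine h.congr fun k => ?_
  rw [kgRate]
  push_cast
  field_simp

theorem kgMeasure_one_zero_eq_map :
    kgMeasure 1 0 = expSeqMeasure.map fun ε => ∑' k, ε k / kgRate k := by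
  rw [kgMeasure]
  congr 1
  ext ε
  rw [← tsum_mul_left]
  refine tsum_congr fun k => ?_
  rw [kgRate]
  simp
  field_simp

theorem aemeasurable_kgSum :
    AEMeasurable (fun ε : ℕ → ℝ => ∑' k, ε k / kgRate k) expSeqMeasure :=
  aemeasurable_tsum_expSeq kgRate_pos summable_one_div_kgRate

instance isProbabilityMeasure_kgMeasure_one_zero : IsProbabilityMeasure (kgMeasure 1 0) := by
  rw [kgMeasure_one_zero_eq_map]
  exact Measure.isProbabilityMeasure_map aemeasurable_kgSum

theorem kgMeasure_real_Ioi {x : ℝ} (hx : 0 < x) : (kgMeasure 1 0).real (Set.Ioi x) = kgTail x := by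
  rw [kgMeasure_one_zero_eq_map, map_measureReal_apply_of_aemeasurable aemeasurable_kgSum
    measurableSet_Ioi]
  refine tendsto_nhds_unique
    (tendsto_measureReal_lt_partialSum kgRate_pos summable_one_div_kgRate x) ?_
  simp_rw [measureReal_lt_partialSum kgRate_injective kgRate_pos _ hx.le]
  exact tendsto_sum_hypoCoeff hx

theorem kgMeasure_Iic_zero : kgMeasure 1 0 (Set.Iic 0) = 0 := by
  have h : ∀ᵐ t ∂(kgMeasure 1 0), 0 < t := by
    rw [kgMeasure_one_zero_eq_map, ae_map_iff aemeasurable_kgSum measurableSet_Ioi]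
    filter_upwards [ae_pos_expSeqMeasure,
      ae_summable_expSeq kgRate_pos summable_one_div_kgRate] with ε hε hs
    exact hs.tsum_pos (fun k => (div_pos (hε k) (kgRate_pos k)).le) 0
      (div_pos (hε 0) (kgRate_pos 0))
  rw [ae_iff] at h
  simpa [Set.Iic_def] using h

/-! ### The density as minus the derivative of the tail. -/

theorem aR_eq (n : ℕ) (x : ℝ) : aR n x = 2 * (kgRate n * Real.exp (-(kgRate n * x))) := by
  rw [aR, kgRate]; ring

/-- The density of `KG(1, 0)`, as the series of the `aR n`. -/
noncomputable def kgDensity (x : ℝ) : ℝ := ∑' n : ℕ, (-1 : ℝ) ^ n * aR n x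

/-- A bound uniform on `[a, ∞)`, used with `a = x / 2` for continuity and termwise differentiation
at `x`. -/
theorem norm_neg_one_pow_mul_aR_le (n : ℕ) {a x : ℝ} (h : a ≤ x) :
    ‖(-1 : ℝ) ^ n * aR n x‖ ≤ 2 * (kgRate n * Real.exp (-(kgRate n * a))) := by
  have hpos := kgRate_pos n
  rw [norm_mul, norm_pow, norm_neg, norm_one, one_pow, one_mul, aR_eq, Real.norm_eq_abs,
    abs_of_nonneg (by positivity)]
  gcongr

theorem hasSum_aR {x : ℝ} (hx : 0 < x) :
    HasSum (fun n : ℕ => (-1 : ℝ) ^ n * aR n x) (kgDensity x) :=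
  (Summable.of_norm_bounded ((summable_kgRate_mul_exp hx).mul_left 2)
    fun n => norm_neg_one_pow_mul_aR_le n le_rfl).hasSum

theorem continuousOn_kgDensity : ContinuousOn kgDensity (Set.Ioi 0) := by
  intro x hx
  have hx' : 0 < x / 2 := half_pos hx
  have h : ContinuousOn kgDensity (Set.Ioi (x / 2)) :=
    continuousOn_tsum (fun n => by unfold aR; fun_prop)
      ((summable_kgRate_mul_exp hx').mul_left 2)
      fun n y hy => norm_neg_one_pow_mul_aR_le n (le_of_lt hy)
  exact (h.continuousAt (Ioi_mem_nhds (half_lt_self hx))).continuousWithinAt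

theorem hasDerivAt_kgTail {x : ℝ} (hx : 0 < x) : HasDerivAt kgTail (-kgDensity x) x := by
  have hx' : 0 < x / 2 := half_pos hx
  have h := hasDerivAt_tsum_of_isPreconnected
    (g := fun k (x : ℝ) => 2 * (-1) ^ k * Real.exp (-(kgRate k * x)))
    (g' := fun k x => -((-1 : ℝ) ^ k * aR k x)) (t := Set.Ioi (x / 2)) (y₀ := x) (y := x)
    ((summable_kgRate_mul_exp hx').mul_left 2) isOpen_Ioi isPreconnected_Ioi
    (fun k y _ => ?_) (fun k y hy => ?_) (half_lt_self hx) ?_ (half_lt_self hx)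
  · rwa [tsum_neg] at h
  · refine ((((hasDerivAt_id y).const_mul (kgRate k)).neg.exp).const_mul
      (2 * (-1) ^ k)).congr_deriv ?_
    rw [aR_eq]
    simp only [id, Pi.neg_apply]
    ring
  · rw [norm_neg]
    exact norm_neg_one_pow_mul_aR_le k (le_of_lt hy)
  · refine Summable.of_norm_bounded ((summable_exp_kgRate hx).mul_left 2) fun k => ?_
    rw [norm_mul, norm_mul, norm_pow, Real.norm_eq_abs (Real.exp _), Real.abs_exp]
    simp

theorem antitoneOn_kgTail : AntitoneOn kgTail (Set.Ioi 0) := by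
  intro x hx y hy hxy
  rw [← kgMeasure_real_Ioi hx, ← kgMeasure_real_Ioi hy]
  exact measureReal_mono (Set.Ioi_subset_Ioi hxy)

/-- The alternating series does not show the sign; it comes from `kgTail` being a tail probability,
hence decreasing. -/
theorem kgDensity_nonneg {x : ℝ} (hx : 0 < x) : 0 ≤ kgDensity x := by
  have h := (hasDerivAt_kgTail hx).hasDerivWithinAt (s := Set.Ioi 0)
  have h2 := antitoneOn_kgTail.derivWithin_nonpos (x := x)
  rw [h.derivWithin (isOpen_Ioi.uniqueDiffWithinAt hx)] at h2
  linarith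

theorem tendsto_kgTail_atTop : Filter.Tendsto kgTail Filter.atTop (nhds 0) := by
  have h : Filter.Tendsto (fun x => kgMeasure 1 0 (Set.Ioi x)) Filter.atTop (nhds 0) := by
    have h := tendsto_measure_iInter_atTop (μ := kgMeasure 1 0) (s := fun x : ℝ => Set.Ioi x)
      (fun x => measurableSet_Ioi.nullMeasurableSet) (fun x y h => Set.Ioi_subset_Ioi h)
      ⟨0, measure_ne_top _ _⟩
    have h0 : ⋂ x : ℝ, Set.Ioi x = ∅ := by
      ext y
      simpa using ⟨y, le_rfl⟩
    rwa [h0, measure_empty] at h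
  have h' := (ENNReal.tendsto_toReal ENNReal.zero_ne_top).comp h
  refine h'.congr' ?_
  filter_upwards [Filter.eventually_gt_atTop 0] with x hx
  exact kgMeasure_real_Ioi hx

theorem setLIntegral_kgDensity {a : ℝ} (ha : 0 < a) :
    ∫⁻ x in Set.Ioi a, ENNReal.ofReal (kgDensity x) = kgMeasure 1 0 (Set.Ioi a) := by
  have hd : ∀ x ∈ Set.Ici a, HasDerivAt kgTail (-kgDensity x) x :=
    fun x hx => hasDerivAt_kgTail (ha.trans_le hx)
  have hnp : ∀ x ∈ Set.Ioi a, -kgDensity x ≤ 0 :=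
    fun x hx => neg_nonpos.2 (kgDensity_nonneg (ha.trans hx))
  have hint := integrableOn_Ioi_deriv_of_nonpos' hd hnp tendsto_kgTail_atTop
  have hval := integral_Ioi_of_hasDerivAt_of_nonpos' hd hnp tendsto_kgTail_atTop
  have hint' : IntegrableOn kgDensity (Set.Ioi a) := by simpa using hint.neg
  rw [integral_neg, zero_sub, neg_inj] at hval
  rw [← ofReal_integral_eq_lintegral_ofReal hint' ?_, hval, ← kgMeasure_real_Ioi ha,
    ofReal_measureReal]
  filter_upwards [ae_restrict_mem measurableSet_Ioi] with x hx
  exact kgDensity_nonneg (ha.trans hx)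

/-! ### Identification of the law and uniqueness of the density. -/

theorem MeasureTheory.Measure.ext_of_Ioi_pos {μ ν : Measure ℝ} [IsFiniteMeasure μ]
    (hμ : μ (Set.Iic 0) = 0) (hν : ν (Set.Iic 0) = 0)
    (h : ∀ a, 0 < a → μ (Set.Ioi a) = ν (Set.Ioi a)) : μ = ν := by
  have hU : ⋃ n : ℕ, Set.Ioi (1 / ((n : ℝ) + 1)) = Set.Ioi 0 := by
    ext x
    simp only [Set.mem_iUnion, Set.mem_Ioi]
    exact ⟨fun ⟨n, hn⟩ => lt_trans (by positivity) hn, exists_nat_one_div_lt⟩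
  have hm : Monotone fun n : ℕ => Set.Ioi (1 / ((n : ℝ) + 1)) :=
    fun m n hmn => Set.Ioi_subset_Ioi (Nat.one_div_le_one_div hmn)
  -- Continuity from below along `1 / (n + 1)` reaches the endpoint 0.
  have h0 : μ (Set.Ioi 0) = ν (Set.Ioi 0) := by
    rw [← hU, hm.measure_iUnion, hm.measure_iUnion]
    exact iSup_congr fun n => h _ (by positivity)
  have hneg : ∀ (ρ : Measure ℝ), ρ (Set.Iic 0) = 0 → ∀ a ≤ 0, ρ (Set.Ioi a) = ρ (Set.Ioi 0) := by
    intro ρ hρ a ha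
    rw [← Set.Ioc_union_Ioi_eq_Ioi ha]
    refine le_antisymm ((measure_union_le _ _).trans ?_) (measure_mono Set.subset_union_right)
    rw [measure_mono_null Set.Ioc_subset_Iic_self hρ, zero_add]
  have hall : ∀ a, μ (Set.Ioi a) = ν (Set.Ioi a) := fun a => by
    rcases lt_or_ge 0 a with ha | ha
    · exact h a ha
    · rw [hneg μ hμ a ha, hneg ν hν a ha, h0]
  refine Measure.ext_of_Ioc μ ν fun a b hab => ?_
  have hs : Set.Ioi b ⊆ Set.Ioi a := Set.Ioi_subset_Ioi hab.le
  have e : Set.Ioc a b = Set.Ioi a \ Set.Ioi b := by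
    ext x; simp
  rw [e, measure_sdiff hs measurableSet_Ioi.nullMeasurableSet (measure_ne_top μ _),
    measure_sdiff hs measurableSet_Ioi.nullMeasurableSet (by rw [← hall]; exact measure_ne_top μ _),
    hall, hall]

theorem isKGDensity_kgDensity : IsKGDensity 1 0 kgDensity where
  continuousOn := continuousOn_kgDensity
  nonneg _ hx := kgDensity_nonneg hx
  law_eq := by
    refine Measure.ext_of_Ioi_pos kgMeasure_Iic_zero ?_ fun a ha => ?_
    · refine withDensity_absolutelyContinuous _ _ ?_
      rw [Measure.restrict_apply measurableSet_Iic, Set.Iic_inter_Ioi, Set.Ioc_self, measure_empty]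
    · rw [withDensity_apply _ measurableSet_Ioi, Measure.restrict_restrict measurableSet_Ioi,
        Set.inter_eq_left.2 (Set.Ioi_subset_Ioi ha.le), setLIntegral_kgDensity ha]

/-- Continuous functions that agree a.e. on an open set agree there. Nonnegativity is what lets
`ENNReal.ofReal` be cancelled. -/
theorem IsKGDensity.eqOn {b c : ℝ} {p q : ℝ → ℝ} (hp : IsKGDensity b c p) (hq : IsKGDensity b c q)
    : Set.EqOn p q (Set.Ioi 0) := by
  have hpm := (hp.continuousOn.aemeasurable (μ := volume) measurableSet_Ioi).ennreal_ofReal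
  have hqm := (hq.continuousOn.aemeasurable (μ := volume) measurableSet_Ioi).ennreal_ofReal
  have h := (withDensity_eq_iff_of_sigmaFinite hpm hqm).1 (hp.law_eq.symm.trans hq.law_eq)
  refine Measure.eqOn_open_of_ae_eq (μ := volume) ?_ isOpen_Ioi hp.continuousOn hq.continuousOn
  filter_upwards [h, ae_restrict_mem measurableSet_Ioi] with x hx hx0
  exact (ENNReal.ofReal_eq_ofReal_iff (hp.nonneg x hx0) (hq.nonneg x hx0)).1 hx

/-! ### Poisson summation and the series of the `aL n`. -/

theorem summable_odd_sq_mul_exp {x : ℝ} (hx : 0 < x) :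
    Summable fun n : ℕ => (2 * (n : ℝ) + 1) ^ 2 * Real.exp (-((2 * (n : ℝ) + 1) ^ 2 / (8 * x))) := by
  have h := (Real.summable_pow_mul_exp_neg_nat_mul 2
    (by positivity : 0 < 1 / (8 * x))).comp_injective
    (i := fun n : ℕ => 2 * n + 1) (fun m n h => by simpa using h)
  refine Summable.of_nonneg_of_le (fun n => by positivity) (fun n => ?_) h
  simp only [Function.comp]
  push_cast
  gcongr ?_ * Real.exp ?_
  have h1 : 2 * (n : ℝ) + 1 ≤ (2 * n + 1) ^ 2 := by nlinarith [Nat.cast_nonneg (α := ℝ) n]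
  rw [neg_mul, neg_le_neg_iff, one_div_mul_eq_div]
  gcongr

theorem summable_odd_exp {x : ℝ} (hx : 0 < x) :
    Summable fun n : ℕ => Real.exp (-((2 * (n : ℝ) + 1) ^ 2 / (8 * x))) :=
  Summable.of_nonneg_of_le (fun _ => Real.exp_nonneg _)
    (fun n => le_mul_of_one_le_left (Real.exp_nonneg _)
      (by nlinarith [Nat.cast_nonneg (α := ℝ) n])) (summable_odd_sq_mul_exp hx)

/-- The alternating theta series as a series over the odd numbers (Poisson summation). -/
theorem tsum_neg_one_zpow_mul_exp {x : ℝ} (hx : 0 < x) :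
    ∑' n : ℤ, (-1 : ℝ) ^ n * Real.exp (-(2 * Real.pi ^ 2 * (n : ℝ) ^ 2 * x)) =
      1 / (2 * Real.pi * x) ^ (1 / 2 : ℝ) *
        ∑' n : ℤ, Real.exp (-((2 * (n : ℝ) + 1) ^ 2 / (8 * x))) := by
  have ha : 0 < 2 * Real.pi * x := by positivity
  -- The linear coefficient `-I / 2` yields `exp (-iπn) = (-1)ⁿ` on the left and shifts `n` to `n +
  -- 1 / 2` on the right, which produces the odd numbers.
  have h := Complex.tsum_exp_neg_quadratic (a := ((2 * Real.pi * x : ℝ) : ℂ))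
    (by rwa [Complex.ofReal_re]) (-Complex.I / 2)
  have hx0 : (x : ℂ) ≠ 0 := by exact_mod_cast hx.ne'
  have hpi : (Real.pi : ℂ) ≠ 0 := by exact_mod_cast Real.pi_ne_zero
  have hl : ∀ n : ℤ, Complex.exp (-Real.pi * ((2 * Real.pi * x : ℝ) : ℂ) * n ^ 2 +
      2 * Real.pi * (-Complex.I / 2) * n) =
      (((-1 : ℝ) ^ n * Real.exp (-(2 * Real.pi ^ 2 * (n : ℝ) ^ 2 * x)) : ℝ) : ℂ) := fun n => by
    rw [Complex.exp_add, mul_comm]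
    have e : 2 * Real.pi * (-Complex.I / 2) * n = n * (-(Real.pi * Complex.I)) := by ring
    rw [e, Complex.exp_int_mul, Complex.exp_neg, Complex.exp_pi_mul_I]
    push_cast
    congr 1
    · norm_num
    · congr 1; ring
  have hr : ∀ n : ℤ, Complex.exp (-Real.pi / ((2 * Real.pi * x : ℝ) : ℂ) *
      (n + Complex.I * (-Complex.I / 2)) ^ 2) =
      ((Real.exp (-((2 * (n : ℝ) + 1) ^ 2 / (8 * x))) : ℝ) : ℂ) := fun n => by
    have e : Complex.I * (-Complex.I / 2) = 1 / 2 := by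
      rw [neg_div, mul_neg, ← mul_div_assoc, Complex.I_mul_I]; norm_num
    rw [e]
    push_cast
    congr 1
    field_simp
    ring
  simp_rw [hl, hr] at h
  have h12 : (1 / 2 : ℂ) = ((1 / 2 : ℝ) : ℂ) := by norm_num
  rw [h12, ← Complex.ofReal_cpow ha.le] at h
  exact_mod_cast h

/-- In the theta series the term at 0 is 1 and `±n` pair up. In the dual series `n ↦ -n - 1`
preserves `(2n + 1)²`, whence the factor 2. -/
theorem one_sub_kgTail {x : ℝ} (hx : 0 < x) :
    1 - kgTail x = 2 / (2 * Real.pi * x) ^ (1 / 2 : ℝ) *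
      ∑' n : ℕ, Real.exp (-((2 * (n : ℝ) + 1) ^ 2 / (8 * x))) := by
  have hL : HasSum (fun n : ℤ => (-1 : ℝ) ^ n * Real.exp (-(2 * Real.pi ^ 2 * (n : ℝ) ^ 2 * x)))
      (1 - kgTail x) := by
    have ht : HasSum (fun k : ℕ => -((-1 : ℝ) ^ k * Real.exp (-(kgRate k * x))))
        (-(kgTail x / 2)) := by
      have hs : Summable fun k : ℕ => (-1 : ℝ) ^ k * Real.exp (-(kgRate k * x)) :=
        Summable.of_norm_bounded (summable_exp_kgRate hx) fun k => by simp
      have e : kgTail x / 2 = ∑' k : ℕ, (-1 : ℝ) ^ k * Real.exp (-(kgRate k * x)) := by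
        rw [kgTail, ← tsum_div_const]
        exact tsum_congr fun k => by ring
      rw [e]
      exact hs.hasSum.neg
    obtain ⟨f, hf⟩ : ∃ f : ℤ → ℝ, ∀ n, f n =
        (-1 : ℝ) ^ n * Real.exp (-(2 * Real.pi ^ 2 * (n : ℝ) ^ 2 * x)) := ⟨_, fun _ => rfl⟩
    simp_rw [← hf]
    have h1 : HasSum (fun n : ℕ => f n) (1 + -(kgTail x / 2)) := by
      have h0 : f (0 : ℕ) = 1 := by simp [hf]
      have h := (hasSum_nat_add_iff (f := fun n : ℕ => f n) 1
        (g := -(kgTail x / 2))).1 (ht.congr_fun fun k => ?_)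
      · rwa [Finset.sum_range_one, h0, add_comm] at h
      · rw [hf, zpow_natCast, pow_succ, kgRate]
        push_cast
        ring_nf
    have h2 : HasSum (fun n : ℕ => f (-(n + 1))) (-(kgTail x / 2)) := by
      refine ht.congr_fun fun k => ?_
      rw [hf, zpow_neg, ← inv_zpow, inv_neg, inv_one, zpow_add_one₀ (by norm_num), zpow_natCast,
        kgRate]
      push_cast
      ring_nf
    have e : 1 - kgTail x = 1 + -(kgTail x / 2) + -(kgTail x / 2) := by ring
    rw [e]
    exact HasSum.of_nat_of_neg_add_one h1 h2
  have hR : HasSum (fun n : ℤ => Real.exp (-((2 * (n : ℝ) + 1) ^ 2 / (8 * x))))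
      ((∑' n : ℕ, Real.exp (-((2 * (n : ℝ) + 1) ^ 2 / (8 * x)))) +
        ∑' n : ℕ, Real.exp (-((2 * (n : ℝ) + 1) ^ 2 / (8 * x)))) := by
    refine HasSum.of_nat_of_neg_add_one ?_ ?_
    · simpa using (summable_odd_exp hx).hasSum
    · convert! (summable_odd_exp hx).hasSum using 1
      ext n
      push_cast
      congr 3
      ring
  rw [← hL.tsum_eq, tsum_neg_one_zpow_mul_exp hx, hR.tsum_eq]
  ring

theorem hasDerivAt_tsum_odd_exp {x : ℝ} (hx : 0 < x) :
    HasDerivAt (fun x : ℝ => ∑' n : ℕ, Real.exp (-((2 * (n : ℝ) + 1) ^ 2 / (8 * x))))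
      ((∑' n : ℕ, (2 * (n : ℝ) + 1) ^ 2 * Real.exp (-((2 * (n : ℝ) + 1) ^ 2 / (8 * x)))) /
        (8 * x ^ 2)) x := by
  -- The upper end of this window bounds the exponentials, the lower end bounds `1 / (8 y²)`.
  have hmem : x ∈ Set.Ioo (x / 2) (2 * x) := ⟨by linarith, by linarith⟩
  have h := hasDerivAt_tsum_of_isPreconnected
    (g := fun (n : ℕ) (x : ℝ) => Real.exp (-((2 * (n : ℝ) + 1) ^ 2 / (8 * x))))
    (g' := fun n x => (2 * (n : ℝ) + 1) ^ 2 * Real.exp (-((2 * (n : ℝ) + 1) ^ 2 / (8 * x))) /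
        (8 * x ^ 2)) (t := Set.Ioo (x / 2) (2 * x)) (y₀ := x) (y := x)
    ((summable_odd_sq_mul_exp (by positivity : 0 < 2 * x)).div_const (8 * (x / 2) ^ 2))
    isOpen_Ioo isPreconnected_Ioo (fun n y hy => ?_) (fun n y hy => ?_) hmem (summable_odd_exp hx)
    hmem
  · rwa [tsum_div_const] at h
  · have hy0 : y ≠ 0 := by linarith [hy.1]
    have h1 := ((((hasDerivAt_id y).const_mul 8).fun_inv (by simpa using hy0)).const_mul
      ((2 * (n : ℝ) + 1) ^ 2)).fun_neg.exp
    refine (h1.congr_deriv ?_)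
    simp only [id]
    rw [← div_eq_mul_inv]
    field_simp
  · have hy0 : 0 < y := by linarith [hy.1]
    rw [Real.norm_eq_abs, abs_of_nonneg (by positivity)]
    have h1 := hy.1.le
    have h2 := hy.2.le
    gcongr

/-- Product rule for `one_sub_kgTail`: the first term differentiates the series, the second the
prefactor. -/
theorem kgDensity_eq_odd {x : ℝ} (hx : 0 < x) :
    kgDensity x =
      (∑' n : ℕ, (2 * (n : ℝ) + 1) ^ 2 * Real.exp (-((2 * (n : ℝ) + 1) ^ 2 / (8 * x)))) /
        (Real.pi ^ (1 / 2 : ℝ) * (2 * x) ^ (5 / 2 : ℝ)) -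
      2 / (Real.pi ^ (1 / 2 : ℝ) * (2 * x) ^ (3 / 2 : ℝ)) *
        ∑' n : ℕ, Real.exp (-((2 * (n : ℝ) + 1) ^ 2 / (8 * x))) := by
  have hpi := Real.pi_pos
  have h1 : HasDerivAt (fun x : ℝ => 2 / Real.pi ^ (1 / 2 : ℝ) * (2 * x) ^ (-1 / 2 : ℝ))
      (2 / Real.pi ^ (1 / 2 : ℝ) * (-(2 * x) ^ (-3 / 2 : ℝ))) x := by
    have h := ((hasDerivAt_id x).const_mul 2).rpow_const (p := (-1 / 2 : ℝ))
      (Or.inl (by simpa using hx.ne'))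
    refine (h.const_mul (2 / Real.pi ^ (1 / 2 : ℝ))).congr_deriv ?_
    norm_num
  have h2 := h1.mul (hasDerivAt_tsum_odd_exp hx)
  have h3 : HasDerivAt (fun x => 1 - kgTail x) (kgDensity x) x := by
    simpa using (hasDerivAt_kgTail hx).const_sub 1
  have h4 := h3.unique (h2.congr_of_eventuallyEq ?_)
  · rw [h4]
    have e1 : (2 * x) ^ (5 / 2 : ℝ) = (2 * x) ^ (1 / 2 : ℝ) * (2 * x) ^ 2 := by
      rw [← Real.rpow_natCast, ← Real.rpow_add (by positivity)]; norm_num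
    have e2 : (2 * x) ^ (3 / 2 : ℝ) = (2 * x) ^ (1 / 2 : ℝ) * (2 * x) := by
      rw [← Real.rpow_add_one (by positivity)]; norm_num
    have e3 : (2 * x) ^ (-3 / 2 : ℝ) = ((2 * x) ^ (3 / 2 : ℝ))⁻¹ := by
      rw [← Real.rpow_neg (by positivity)]; norm_num
    have e4 : (2 * x) ^ (-1 / 2 : ℝ) = ((2 * x) ^ (1 / 2 : ℝ))⁻¹ := by
      rw [← Real.rpow_neg (by positivity)]; norm_num
    rw [e3, e4, e1, e2]
    have p1 : 0 < (2 * x) ^ (1 / 2 : ℝ) := by positivity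
    have p2 : 0 < Real.pi ^ (1 / 2 : ℝ) := by positivity
    field_simp
    ring
  · filter_upwards [Ioi_mem_nhds hx] with y hy
    have hy' : (0 : ℝ) < y := hy
    rw [one_sub_kgTail hy', Pi.mul_apply]
    congr 1
    have e4 : (2 * y) ^ (-1 / 2 : ℝ) = ((2 * y) ^ (1 / 2 : ℝ))⁻¹ := by
      rw [← Real.rpow_neg (by positivity)]; norm_num
    have e5 : (2 * Real.pi * y) ^ (1 / 2 : ℝ) =
        Real.pi ^ (1 / 2 : ℝ) * (2 * y) ^ (1 / 2 : ℝ) := by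
      rw [← Real.mul_rpow hpi.le (by positivity)]
      congr 1; ring
    rw [e4, e5, ← div_div, div_eq_mul_inv _ ((2 * y) ^ (1 / 2 : ℝ))]

theorem aL_two_mul (m : ℕ) (x : ℝ) : aL (2 * m) x =
    (2 * (m : ℝ) + 1) ^ 2 * Real.exp (-((2 * (m : ℝ) + 1) ^ 2 / (8 * x))) /
      (Real.pi ^ (1 / 2 : ℝ) * (2 * x) ^ (5 / 2 : ℝ)) := by
  rw [aL, if_neg (by simp)]
  push_cast
  ring

theorem aL_two_mul_add_one (m : ℕ) (x : ℝ) : aL (2 * m + 1) x =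
    2 / (Real.pi ^ (1 / 2 : ℝ) * (2 * x) ^ (3 / 2 : ℝ)) *
      Real.exp (-((2 * (m : ℝ) + 1) ^ 2 / (8 * x))) := by
  rw [aL, if_pos (by simp)]
  push_cast
  rfl

/-- The indices `2m` and `2m + 1` both carry the odd number `2m + 1`. Each of the two series
converges by itself, so they may be interleaved. -/
theorem hasSum_aL {x : ℝ} (hx : 0 < x) :
    HasSum (fun n : ℕ => (-1 : ℝ) ^ n * aL n x) (kgDensity x) := by
  rw [kgDensity_eq_odd hx, sub_eq_add_neg]
  refine HasSum.even_add_odd ?_ ?_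
  · simp only [aL_two_mul, pow_mul, neg_one_sq, one_pow, one_mul]
    exact (summable_odd_sq_mul_exp hx).hasSum.div_const _
  · refine ((summable_odd_exp hx).hasSum.mul_left _).neg.congr_fun fun m => ?_
    rw [aL_two_mul_add_one, pow_succ, pow_mul, neg_one_sq, one_pow, one_mul, neg_one_mul]

theorem aL_pos (n : ℕ) {x : ℝ} (hx : 0 < x) : 0 < aL n x := by
  unfold aL
  split_ifs <;> positivity

theorem aR_pos (n : ℕ) (x : ℝ) : 0 < aR n x := by
  unfold aR
  positivity

/-- `HasSum` over `ℕ` in `ℝ` is unconditional, so it includes absolute convergence. -/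
theorem proposition2 :
    (∃ p : ℝ → ℝ, IsKGDensity 1 0 p) ∧
    (∀ p : ℝ → ℝ, IsKGDensity 1 0 p → ∀ x : ℝ, 0 < x →
      HasSum (fun n : ℕ => (-1 : ℝ) ^ n * aL n x) (p x) ∧
      HasSum (fun n : ℕ => (-1 : ℝ) ^ n * aR n x) (p x)) ∧
    (∀ (n : ℕ) (x : ℝ), 0 < x → 0 < aL n x ∧ 0 < aR n x) := by
  refine ⟨⟨kgDensity, isKGDensity_kgDensity⟩, fun p hp x hx => ?_,
    fun n x hx => ⟨aL_pos n hx, aR_pos n x⟩⟩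
  rw [hp.eqOn isKGDensity_kgDensity hx]
  exact ⟨hasSum_aL hx, hasSum_aR hx⟩
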